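/- For a positive integer $n$ let $\Omega_n=\{0,1,-1,\dots,n,-n\}$ and let $\mathfrak B_n$ be the hyperoctahedral group of all signed permutations of length $n$, that is, of all bijections $\pi:\Omega_n\to\Omega_n$ with $\pi(-a)=-\pi(a)$ for every $a\in\Omega_n$; write $\pi_i=\pi(i)$ for $0\le i\le n$, so that $\pi_0=0$. Let $<_r$ be the total order $$-1<_r-2<_r-3<_r\cdots<_r0<_r1<_r2<_r3<_r\cdots$$ on $\mathbb Z$, and let $\mathrm{des}_B(\pi)=\#\{i\in\{0,1,\dots,n-1\} : \pi_i>_r\pi_{i+1}\}$. For $k\in\mathbb Z$ let $I^{\underline B}_{n,k}$ be the number of $\pi\in\mathfrak B_n$ with $\pi^{-1}=\pi$ and $\mathrm{des}_B(\pi)=k$. Theorem. For all integers $n\ge 3$ and $k\ge 0$, $$\begin{aligned} n I^{\underline B}_{n,k}={}&(2k+1)\,I^{\underline B}_{n-1,k}+(2n-2k+1)\,I^{\underline B}_{n-1,k-1}+\bigl(n-1+2k(k+1)\bigr)I^{\underline B}_{n-2,k}\\ &+\bigl(2(n-1)+4(n-k-1)(k-1)\bigr)I^{\underline B}_{n-2,k-1}\\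 &+\bigl((2n-3)(n-1)+2(k-2)(k-2n+1)\bigr)I^{\underline B}_{n-2,k-2}, \end{aligned}$$ where $I^{\underline B}_{1,0}=1$, $I^{\underline B}_{1,1}=1$, $I^{\underline B}_{2,0}=1$, $I^{\underline B}_{2,1}=4$, $I^{\underline B}_{2,2}=1$, and $I^{\underline B}_{n,k}=0$ for all $n\ge1$ and $k<0$. -/

import Mathlib

/-- The set `Ω_n = {0, 1, -1, …, n, -n}`. -/
abbrev SignedSet (n : ℕ) : Type := {a : ℤ // -(n : ℤ) ≤ a ∧ a ≤ n}

instance SignedSet.instNeg (n : ℕ) : Neg (SignedSet n) :=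
  ⟨fun a => ⟨-a.1, by have := a.2; omega⟩⟩

/-- The element `i` of `Ω_n`, for a natural number `i ≤ n`. -/
def SignedSet.ofNat {n : ℕ} (i : ℕ) (hi : i ≤ n) : SignedSet n :=
  ⟨(i : ℤ), by omega⟩

/-- The hyperoctahedral group: the bijections `π : Ω_n → Ω_n` such that `π a = b` implies
`π (-a) = -b`, as a subgroup of the group of all permutations of `Ω_n`. -/
def Hyperoctahedral (n : ℕ) : Subgroup (Equiv.Perm (SignedSet n)) where
  carrier := {π | ∀ a : SignedSet n, π (-a) = -π a}
  one_mem' := fun _ => rfl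
  mul_mem' := by
    intro π σ hπ hσ a
    show π (σ (-a)) = -π (σ a)
    rw [hσ a, hπ (σ a)]
  inv_mem' := by
    intro π hπ a
    show π.symm (-a) = -π.symm a
    rw [Equiv.symm_apply_eq, hπ (π.symm a), Equiv.apply_symm_apply]

/-- The strict `r`-order `-1 <_r -2 <_r ⋯ <_r 0 <_r 1 <_r 2 <_r ⋯` on the integers. -/
def RLt (a b : ℤ) : Prop :=
  (a < 0 ∧ b < 0 ∧ b < a) ∨ (a < 0 ∧ 0 ≤ b) ∨ (0 ≤ a ∧ a < b)

instance RLt.instDecidable (a b : ℤ) : Decidable (RLt a b) := by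
  unfold RLt; infer_instance

/-- `π_i = π(i)` for `0 ≤ i ≤ n`; in particular `π_0 = π(0)`. -/
def Hyperoctahedral.entry {n : ℕ} (π : Hyperoctahedral n) (i : ℕ) (hi : i ≤ n) : ℤ :=
  (π.1 (SignedSet.ofNat i hi)).1

/-- The set of `i ∈ {0, …, n - 1}` with `π_i >_r π_{i+1}`. -/
def Hyperoctahedral.rDescents {n : ℕ} (π : Hyperoctahedral n) : Finset (Fin n) :=
  Finset.univ.filter fun i =>
    RLt (entry π (i.1 + 1) (Nat.succ_le_of_lt i.2)) (entry π i.1 i.2.le)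

/-- The number of descents of `π` under the `r`-order. -/
def Hyperoctahedral.rDes {n : ℕ} (π : Hyperoctahedral n) : ℕ := (rDescents π).card

/-- The signed involutions of length `n` with exactly `k` descents under the `r`-order. -/
def signedInvolutions (n : ℕ) (k : ℤ) : Set (Hyperoctahedral n) :=
  {π | π⁻¹ = π ∧ (Hyperoctahedral.rDes π : ℤ) = k}

/-- The number of signed involutions of length `n` with exactly `k` descents
under the `r`-order. -/
noncomputable def signedInvolutionCount (n : ℕ) (k : ℤ) : ℕ := (signedInvolutions n k).ncard

/-! Fix `m` and count symmetric matrices of natural numbers, indexed by `{0, …, 2m}`, with total `n`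
and support on index pairs of equal parity. There are `2m+1` free diagonal entries and `m²` free
off-diagonal ones, each of the latter counted twice in the total, so the generating function is `F =
(1-x)^{-(2m+1)} (1-x²)^{-m²}`. The equation `(1-x²)F' = (2m+1+(2m²+2m+1)x)F` is a recurrence in `n`;
`card_symmMatrices_recurrence` proves it by double counting.

The same matrices encode signed involutions. Listing the index pairs of a matrix in lexicographic
order gives a word `c`, and stable sorting turns symmetry into an involution `σ` with `c i` and `c
(σ i)` of equal parity (`ncard_colouredInvolutions`). Reading odd letters as minus signs, `σ`
becomes a signed involution `π`, and the words compatible with `π` number `C(n+m-des π, n)`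
(`ncard_parityWords`). Hence `∑_k I_{n,k} C(n+m-k, n)` satisfies the matrix recurrence for every
`m`.

Its coefficients depend on `m`. Binomial identities absorb them and express everything through
`C(n+2+m-k, n+2)`. This system is triangular in `k ≤ m` with unit diagonal, so the coefficients
agree one by one. -/

/-! ### Symmetric matrices with prescribed support and total -/

open Finset in
/-- The functions `M : C × C → ℕ` with support in `s` and total sum `n` that are symmetric. -/
noncomputable def symmMatrices {C : Type*} [DecidableEq C] (s : Finset (C × C)) (n : ℕ) :
    Finset (C × C → ℕ) := by
  classical exact (piAntidiag s n).filter fun M => ∀ p, M p.swap = M p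

section SymmMatrices

variable {C : Type*} [DecidableEq C] {s : Finset (C × C)} {n : ℕ} {M : C × C → ℕ}

theorem mem_symmMatrices :
    M ∈ symmMatrices s n ↔ (∑ p ∈ s, M p = n ∧ ∀ p, M p ≠ 0 → p ∈ s) ∧ ∀ p, M p.swap = M p := by
  simp [symmMatrices, Finset.mem_piAntidiag]

/-- Adding a symmetric elementary matrix at `p`. -/
theorem sum_symmMatrices_add {e : C × C → ℕ} {w : ℕ} {p : C × C}
    (hes : ∀ q, e q ≠ 0 → q ∈ s) (hesymm : ∀ q, e q.swap = e q) (hew : ∑ q ∈ s, e q = w)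
    (hep : e p = 1) (hle : ∀ M ∈ symmMatrices s (n + w), M p ≠ 0 → e ≤ M) :
    ∑ M ∈ symmMatrices s (n + w), M p = ∑ M ∈ symmMatrices s n, (M p + 1) := by
  classical
  -- Matrices vanishing at `p` contribute nothing; adding `e` matches the others with all matrices
  -- of total `n`.
  rw [← Finset.sum_filter_ne_zero]
  symm
  refine Finset.sum_bij (fun M _ => M + e) ?_ ?_ ?_ ?_
  · intro M hM
    rw [mem_symmMatrices] at hM
    rw [Finset.mem_filter, mem_symmMatrices]
    refine ⟨⟨⟨?_, ?_⟩, ?_⟩, ?_⟩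
    · simp only [Pi.add_apply, Finset.sum_add_distrib, hew, hM.1.1]
    · intro q hq
      by_cases h : M q = 0
      · exact hes q (by simpa [h] using hq)
      · exact hM.1.2 q h
    · intro q
      simp [hM.2 q, hesymm q]
    · simp [hep]
  · intro M _ M' _ h
    exact add_right_cancel h
  · intro M hM
    rw [Finset.mem_filter] at hM
    have hadd : M - e + e = M := tsub_add_cancel_of_le (hle M hM.1 hM.2)
    have hM' := mem_symmMatrices.1 hM.1
    refine ⟨M - e, ?_, hadd⟩
    rw [mem_symmMatrices]
    refine ⟨⟨?_, ?_⟩, ?_⟩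
    · have := hM'.1.1
      rw [← hadd] at this
      simp only [Pi.add_apply, Finset.sum_add_distrib, hew] at this
      omega
    · intro q hq
      refine hM'.1.2 q fun h => hq ?_
      simp [h]
    · intro q
      simp [hM'.2 q, hesymm q]
  · intro M _
    simp [hep]

theorem sum_symmMatrices_diag {a : C} (ha : (a, a) ∈ s) :
    ∑ M ∈ symmMatrices s (n + 1), M (a, a) = ∑ M ∈ symmMatrices s n, (M (a, a) + 1) := by
  refine sum_symmMatrices_add (e := Pi.single (a, a) 1) ?_ ?_ ?_ (by simp) ?_
  · intro q hq
    by_cases h : q = (a, a)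
    · rwa [h]
    · simp [h] at hq
  · rintro ⟨x, y⟩
    simp only [Pi.single_apply, Prod.swap_prod_mk, Prod.mk.injEq, and_comm]
  · simp [ha]
  · intro M _ h q
    by_cases h' : q = (a, a)
    · subst h'
      simpa using Nat.one_le_iff_ne_zero.2 h
    · simp [h']

theorem sum_symmMatrices_offDiag {a b : C} (hab : a ≠ b) (h₁ : (a, b) ∈ s) (h₂ : (b, a) ∈ s) :
    ∑ M ∈ symmMatrices s (n + 2), M (a, b) = ∑ M ∈ symmMatrices s n, (M (a, b) + 1) := by
  have hne : (a, b) ≠ (b, a) := by simp [hab]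
  refine sum_symmMatrices_add (e := Pi.single (a, b) 1 + Pi.single (b, a) 1) ?_ ?_ ?_ ?_ ?_
  · intro q hq
    by_cases h : q = (a, b)
    · rwa [h]
    by_cases h' : q = (b, a)
    · rwa [h']
    simp [h, h'] at hq
  · rintro ⟨x, y⟩
    simp only [Pi.add_apply, Pi.single_apply, Prod.swap_prod_mk, Prod.mk.injEq]
    rw [add_comm]
    simp only [and_comm]
  · simp [Finset.sum_add_distrib, h₁, h₂]
  · simp [hne]
  · intro M hM h q
    have hsw := (mem_symmMatrices.1 hM).2 (a, b)
    simp only [Prod.swap_prod_mk] at hsw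
    by_cases h₁ : q = (a, b)
    · subst h₁
      simpa [hne] using Nat.one_le_iff_ne_zero.2 h
    by_cases h₂ : q = (b, a)
    · subst h₂
      simpa [hne.symm, hsw] using Nat.one_le_iff_ne_zero.2 h
    simp [h₁, h₂]

theorem sum_sum_symmMatrices :
    ∑ p ∈ s, ∑ M ∈ symmMatrices s n, M p = n * (symmMatrices s n).card := by
  rw [Finset.sum_comm, Finset.sum_congr rfl fun M hM => (mem_symmMatrices.1 hM).1.1]
  simp [mul_comm]

/-- Double counting of the sum of all entries of all matrices. An off-diagonal unit costs 2 in the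
total and leads from `n + 2` straight to `n`. A diagonal unit costs 1, so two removals are needed,
and the first leaves one extra copy of the count at `n + 1` for each diagonal position. -/
theorem card_symmMatrices_recurrence [Fintype C] (hdiag : ∀ a, (a, a) ∈ s)
    (hswap : ∀ p ∈ s, p.swap ∈ s) :
    (n + 2) * (symmMatrices s (n + 2)).card =
      Fintype.card C * (symmMatrices s (n + 1)).card +
        (n + s.card) * (symmMatrices s n).card := by
  have key : ∀ p ∈ s, ∑ M ∈ symmMatrices s (n + 2), M p =
      (∑ M ∈ symmMatrices s n, M p + (symmMatrices s n).card) +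
        if p.1 = p.2 then (symmMatrices s (n + 1)).card else 0 := by
    rintro ⟨a, b⟩ hp
    by_cases hab : a = b
    · subst hab
      rw [sum_symmMatrices_diag hp, Finset.sum_add_distrib, sum_symmMatrices_diag hp,
        Finset.sum_add_distrib]
      simp
    · rw [sum_symmMatrices_offDiag hab hp (hswap _ hp), Finset.sum_add_distrib]
      simp [hab]
  have hd : (s.filter fun p => p.1 = p.2).card = Fintype.card C := by
    rw [← Finset.card_univ]
    symm
    refine Finset.card_bij (fun a _ => (a, a)) ?_ ?_ ?_
    · intro a _
      simp [hdiag a]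
    · intro a _ b _ h
      exact congrArg Prod.fst h
    · rintro ⟨a, b⟩ h
      obtain ⟨_, rfl⟩ : (a, b) ∈ s ∧ a = b := by simpa using h
      exact ⟨a, by simp, rfl⟩
  rw [← sum_sum_symmMatrices, Finset.sum_congr rfl key, Finset.sum_add_distrib,
    Finset.sum_add_distrib, sum_sum_symmMatrices, ← Finset.sum_filter, Finset.sum_const,
    Finset.sum_const, hd]
  simp only [smul_eq_mul]
  ring

end SymmMatrices

/-! ### Symmetric matrices as coloured involutions -/

/-- The pairs of a word `c` and an involution `σ` such that `i ↦ (c i, σ i)` increases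
lexicographically and `(c i, c (σ i))` always lies in `s`. -/
def colouredInvolutions {C : Type*} [LinearOrder C] (s : Finset (C × C)) (n : ℕ) :
    Set ((Fin n → C) × Equiv.Perm (Fin n)) :=
  {p | StrictMono (fun i => toLex (p.1 i, p.2 i)) ∧ (∀ i, p.2 (p.2 i) = i) ∧
    ∀ i, (p.1 i, p.1 (p.2 i)) ∈ s}

section ColouredInvolutions

variable {C : Type*} [LinearOrder C] {s : Finset (C × C)} {n : ℕ}

/-- Bijections between the fibres assemble to a permutation carrying one word to the other, and a
word has only one monotone rearrangement. -/
theorem Monotone.eq_of_card_fiber_eq {α : Type*} [LinearOrder α] {f g : Fin n → α}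
    (hf : Monotone f) (hg : Monotone g)
    (h : ∀ a, (Finset.univ.filter fun i => f i = a).card =
      (Finset.univ.filter fun i => g i = a).card) : f = g := by
  have e : ∀ a, Nonempty ({i // f i = a} ≃ {i // g i = a}) := fun a =>
    Fintype.card_eq.1 (by rw [Fintype.card_subtype, Fintype.card_subtype, h a])
  let τ : Equiv.Perm (Fin n) := Equiv.ofFiberEquiv fun a => (e a).some
  have hτ : g ∘ τ = f := funext fun i => Equiv.ofFiberEquiv_map _ i
  have := Tuple.unique_monotone (f := g) (σ := τ) (τ := 1) (by rwa [hτ]) (by simpa using hg)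
  rw [hτ] at this
  simpa using this

theorem exists_monotone_card_fiber_eq {α : Type*} [LinearOrder α] {s : Finset α} {M : α → ℕ}
    (hs : ∀ a, M a ≠ 0 → a ∈ s) (hM : ∑ a ∈ s, M a = n) :
    ∃ f : Fin n → α, Monotone f ∧ ∀ a, (Finset.univ.filter fun i => f i = a).card = M a := by
  have hcard : Fintype.card (Fin n) = Fintype.card (Σ a : s, Fin (M a)) := by
    rw [Fintype.card_sigma]
    simp only [Fintype.card_fin, ← hM]
    exact (Finset.sum_coe_sort s M).symm
  let e : Fin n ≃ Σ a : s, Fin (M a) := Fintype.equivOfCardEq hcard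
  let f₀ : Fin n → α := fun i => (e i).1
  refine ⟨f₀ ∘ Tuple.sort f₀, Tuple.monotone_sort f₀, fun a => ?_⟩
  have h₁ : (Finset.univ.filter fun i => (f₀ ∘ Tuple.sort f₀) i = a).card =
      (Finset.univ.filter fun i => f₀ i = a).card := by
    refine Finset.card_bij (fun i _ => Tuple.sort f₀ i) ?_ ?_ ?_
    · intro i hi
      simpa using hi
    · intro i _ j _ h
      exact (Tuple.sort f₀).injective h
    · intro i hi
      exact ⟨(Tuple.sort f₀).symm i, by simpa using hi, by simp⟩
  rw [h₁]
  by_cases ha : a ∈ s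
  · rw [← Fintype.card_fin (M a), ← Fintype.card_subtype]
    refine Fintype.card_congr ?_
    exact (e.subtypeEquiv (q := fun x => x.1 = (⟨a, ha⟩ : s)) fun i => by
      simp [f₀, Subtype.ext_iff]).trans (Equiv.sigmaSubtype (⟨a, ha⟩ : s))
  · have h0 : M a = 0 := by
      by_contra h
      exact ha (hs a h)
    rw [h0, Finset.card_eq_zero, Finset.filter_eq_empty_iff]
    rintro i - rfl
    exact ha (e i).1.2

theorem Equiv.Perm.eq_one_of_strictMono {τ : Equiv.Perm (Fin n)} (h : StrictMono τ) : τ = 1 := by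
  have h₁ := Tuple.unique_monotone (f := (id : Fin n → Fin n)) (σ := τ) (τ := 1)
    (by simpa using h.monotone) (by simpa using monotone_id)
  ext i
  simpa using congrArg Fin.val (congrFun h₁ i)

/-- The word of pairs `(c i, c (σ i))`. -/
def pairWord (p : (Fin n → C) × Equiv.Perm (Fin n)) (i : Fin n) : C ×ₗ C :=
  toLex (p.1 i, p.1 (p.2 i))

/-- The matrix counting the pairs `(c i, c (σ i))`. -/
def pairMatrix (p : (Fin n → C) × Equiv.Perm (Fin n)) (q : C × C) : ℕ :=
  (Finset.univ.filter fun i => (p.1 i, p.1 (p.2 i)) = q).card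

theorem monotone_fst_of_mem {p : (Fin n → C) × Equiv.Perm (Fin n)}
    (hp : p ∈ colouredInvolutions s n) : Monotone p.1 := fun i j hij => by
  have := hp.1.monotone hij
  rw [Prod.Lex.toLex_le_toLex] at this
  rcases this with h | h
  · exact h.le
  · exact h.1.le

theorem monotone_pairWord {p : (Fin n → C) × Equiv.Perm (Fin n)}
    (hp : p ∈ colouredInvolutions s n) : Monotone (pairWord p) := fun i j hij => by
  have := hp.1.monotone hij
  rw [Prod.Lex.toLex_le_toLex] at this
  rw [pairWord, pairWord, Prod.Lex.toLex_le_toLex]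
  rcases this with h | h
  · exact Or.inl h
  · exact Or.inr ⟨h.1, monotone_fst_of_mem hp h.2⟩

/-- `Tuple.sort` is the stable sort. As `σ` is an involution, `(c ∘ σ) ∘ σ = c` is monotone, and the
lexicographic condition makes `σ` increase on ties. Thus `c ∘ σ` determines `σ`. -/
theorem eq_sort_of_mem {p : (Fin n → C) × Equiv.Perm (Fin n)}
    (hp : p ∈ colouredInvolutions s n) : p.2 = Tuple.sort (p.1 ∘ p.2) := by
  rw [Tuple.eq_sort_iff]
  have h : (p.1 ∘ p.2) ∘ p.2 = p.1 := funext fun i => by simp [hp.2.1 i]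
  refine ⟨by rw [h]; exact monotone_fst_of_mem hp, fun i j hij he => ?_⟩
  have he' : p.1 i = p.1 j := by simpa [hp.2.1] using he
  have := hp.1 hij
  rw [Prod.Lex.toLex_lt_toLex] at this
  exact (this.resolve_left (by simp [he'])).2

theorem pairMatrix_mem {p : (Fin n → C) × Equiv.Perm (Fin n)}
    (hp : p ∈ colouredInvolutions s n) : pairMatrix p ∈ symmMatrices s n := by
  rw [mem_symmMatrices]
  refine ⟨⟨?_, ?_⟩, ?_⟩
  · have := Finset.card_eq_sum_card_fiberwise (s := Finset.univ) (t := s)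
      (f := fun i : Fin n => (p.1 i, p.1 (p.2 i))) (fun i _ => hp.2.2 i)
    rw [Finset.card_univ, Fintype.card_fin] at this
    exact this.symm
  · intro q hq
    obtain ⟨i, hi⟩ := Finset.card_ne_zero.1 hq
    rw [Finset.mem_filter] at hi
    exact hi.2 ▸ hp.2.2 i
  · rintro ⟨a, b⟩
    refine Finset.card_bij (fun i _ => p.2 i) ?_ ?_ ?_
    · intro i hi
      simpa [hp.2.1 i, and_comm] using hi
    · intro i _ j _ h
      exact p.2.injective h
    · intro i hi
      refine ⟨p.2 i, ?_, hp.2.1 i⟩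
      simpa [hp.2.1 i, and_comm] using hi

theorem pairMatrix_injOn : Set.InjOn pairMatrix (colouredInvolutions s n) := by
  intro p hp q hq h
  have hw : pairWord p = pairWord q :=
    (monotone_pairWord hp).eq_of_card_fiber_eq (monotone_pairWord hq) fun a =>
      congrFun h (ofLex a)
  have h₁ : p.1 = q.1 := funext fun i => congrArg (fun x => (ofLex x).1) (congrFun hw i)
  have h₂ : p.1 ∘ p.2 = q.1 ∘ q.2 :=
    funext fun i => congrArg (fun x => (ofLex x).2) (congrFun hw i)
  refine Prod.ext h₁ ?_
  rw [eq_sort_of_mem hp, eq_sort_of_mem hq, h₂]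

/-- The pairs `(c i, h i)` are listed in lexicographic order with multiplicities `M`, and `σ` is the
stable sort of `h`. Symmetry of `M` gives first `h ∘ σ = c`, then `c ∘ σ = h`, and so `σ² = 1`. -/
theorem exists_pairMatrix_eq {M : C × C → ℕ} (hM : M ∈ symmMatrices s n) :
    ∃ p ∈ colouredInvolutions s n, pairMatrix p = M := by
  rw [mem_symmMatrices] at hM
  obtain ⟨⟨hsum, hsupp⟩, hsymm⟩ := hM
  obtain ⟨g, hg, hgM⟩ := exists_monotone_card_fiber_eq (α := C ×ₗ C) (n := n)
    (s := s.map toLex.toEmbedding) (M := fun a => M (ofLex a))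
    (fun a ha => Finset.mem_map.2 ⟨ofLex a, hsupp _ ha, rfl⟩) (by rw [Finset.sum_map]; exact hsum)
  let c : Fin n → C := fun i => (ofLex (g i)).1
  let h : Fin n → C := fun i => (ofLex (g i)).2
  have hgi : ∀ i, g i = toLex (c i, h i) := fun i => rfl
  have hc : Monotone c := fun i j hij => by
    have := hg hij
    rw [hgi, hgi, Prod.Lex.toLex_le_toLex] at this
    rcases this with h | h
    · exact h.le
    · exact h.1.le
  let σ := Tuple.sort h
  obtain ⟨hσ₁, hσ₂⟩ := Tuple.eq_sort_iff.1 (rfl : σ = Tuple.sort h)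
  have hfib : ∀ a b, (Finset.univ.filter fun i => h i = a ∧ c i = b).card =
      (Finset.univ.filter fun i => c i = a ∧ h i = b).card := by
    intro a b
    have h₁ := hgM (toLex (a, b))
    have h₂ := hgM (toLex (b, a))
    have h₃ := hsymm (b, a)
    simp only [hgi, EmbeddingLike.apply_eq_iff_eq, Prod.mk.injEq, ofLex_toLex] at h₁ h₂
    simp only [Prod.swap_prod_mk] at h₃
    rw [h₁, h₃, ← h₂]
    simp only [and_comm]
  have hσfib : ∀ (P : Fin n → Prop) [DecidablePred P],
      (Finset.univ.filter fun i => P (σ i)).card = (Finset.univ.filter P).card := by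
    intro P _
    refine Finset.card_bij (fun i _ => σ i) ?_ ?_ ?_
    · intro i hi
      simpa using hi
    · intro i _ j _ h
      exact σ.injective h
    · intro i hi
      exact ⟨σ.symm i, by simpa using hi, by simp⟩
  have hcσ : h ∘ σ = c := by
    refine hσ₁.eq_of_card_fiber_eq hc fun a => ?_
    rw [show (Finset.univ.filter fun i => (h ∘ σ) i = a).card = _ from hσfib fun i => h i = a]
    have hsplit : ∀ u v : Fin n → C, ∀ t : Finset C, (∀ i, v i ∈ t) →
        (Finset.univ.filter fun i => u i = a).card =
        ∑ b ∈ t, (Finset.univ.filter fun i => u i = a ∧ v i = b).card := by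
      intro u v t ht
      rw [Finset.card_eq_sum_card_fiberwise (t := t) (f := v) (fun i _ => ht i)]
      simp only [Finset.filter_filter]
    -- The alphabet may be infinite, so the sum runs over the letters that occur in either word.
    rw [hsplit h c (Finset.univ.image c ∪ Finset.univ.image h) (by simp),
      hsplit c h (Finset.univ.image c ∪ Finset.univ.image h) (by simp)]
    exact Finset.sum_congr rfl fun b _ => hfib a b
  have hcσ' : ∀ i, h (σ i) = c i := fun i => congrFun hcσ i
  have hlt : ∀ i j, i < j → c i = c j → σ i < σ j := fun i j hij he =>
    hσ₂ i j hij (by simpa [hcσ'] using he)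
  have hmono : Monotone (fun i => toLex (c i, c (σ i))) := by
    intro i j hij
    rw [Prod.Lex.toLex_le_toLex]
    rcases hij.eq_or_lt with rfl | hij
    · simp
    rcases (hc hij.le).eq_or_lt with he | he
    · exact Or.inr ⟨he, hc (hlt i j hij he).le⟩
    · exact Or.inl he
  have hg' : (fun i => toLex (c i, c (σ i))) = g := by
    refine hmono.eq_of_card_fiber_eq hg fun a => ?_
    obtain ⟨⟨a, b⟩, rfl⟩ := toLex.surjective a
    simp only [hgi, EmbeddingLike.apply_eq_iff_eq, Prod.mk.injEq, ← hcσ']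
    rw [hσfib fun i => h i = a ∧ h (σ i) = b]
    simp only [hcσ']
    exact hfib a b
  have hh : ∀ i, c (σ i) = h i := fun i => congrArg (fun x => (ofLex x).2) (congrFun hg' i)
  have hinv : σ * σ = 1 := by
    -- `σ²` preserves the sorted word `g`, and `σ` increases wherever `c` is constant. So `σ²` keeps
    -- the order both between different values of `g` and within each of its fibres.
    refine Equiv.Perm.eq_one_of_strictMono fun i j hij => ?_
    have hσσ : ∀ i, g (σ (σ i)) = g i := fun i => by
      rw [hgi, hgi, hh, hcσ', hcσ', hh]
    simp only [Equiv.Perm.coe_mul, Function.comp_apply]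
    rcases (hg hij.le).eq_or_lt with he | he
    · have h₁ : c i = c j := congrArg (fun x => (ofLex x).1) he
      have h₂ : h i = h j := congrArg (fun x => (ofLex x).2) he
      exact hlt _ _ (hlt _ _ hij h₁) (by rw [hh, hh, h₂])
    · rw [← hσσ i, ← hσσ j] at he
      exact hg.reflect_lt he
  refine ⟨(c, σ), ⟨?_, ?_, ?_⟩, ?_⟩
  · intro i j hij
    rw [Prod.Lex.toLex_lt_toLex]
    rcases (hc hij.le).eq_or_lt with he | he
    · exact Or.inr ⟨he, hlt i j hij he⟩
    · exact Or.inl he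
  · intro i
    exact congrArg (fun τ : Equiv.Perm (Fin n) => τ i) hinv
  · intro i
    simp only [hh]
    refine hsupp _ ?_
    have := hgM (g i)
    rw [hgi, ofLex_toLex] at this
    rw [← this, Finset.card_ne_zero]
    exact ⟨i, by simp [hgi]⟩
  · funext q
    have := hgM (toLex q)
    rw [ofLex_toLex] at this
    rw [← this, pairMatrix]
    simp only [hh]
    rfl

theorem ncard_colouredInvolutions :
    (colouredInvolutions s n).ncard = (symmMatrices s n).card := by
  rw [← Set.ncard_coe_finset, ← pairMatrix_injOn.ncard_image]
  congr 1
  ext M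
  constructor
  · rintro ⟨p, hp, rfl⟩
    exact pairMatrix_mem hp
  · intro hM
    exact exists_pairMatrix_eq hM

end ColouredInvolutions

/-! ### Counting chains with prescribed gaps -/

/-- The sequences `0 = f 0 ≤ f 1 ≤ ⋯ ≤ f n ≤ m` that grow by at least `b i` at step `i`. -/
def gapChains {n : ℕ} (b : Fin n → ℕ) (m : ℕ) : Set (Fin (n + 1) → ℕ) :=
  {f | f 0 = 0 ∧ (∀ i : Fin n, f i.castSucc + b i ≤ f i.succ) ∧ f (Fin.last n) ≤ m}

section GapChains

variable {n : ℕ}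

theorem monotone_of_mem_gapChains {b : Fin n → ℕ} {m : ℕ} {f : Fin (n + 1) → ℕ}
    (hf : f ∈ gapChains b m) : Monotone f :=
  Fin.monotone_iff_le_succ.2 fun i => le_trans (Nat.le_add_right _ _) (hf.2.1 i)

theorem finite_gapChains (b : Fin n → ℕ) (m : ℕ) : (gapChains b m).Finite :=
  (Set.finite_Iic (fun _ : Fin (n + 1) => m)).subset fun _ hf i =>
    le_trans (monotone_of_mem_gapChains hf (Fin.le_last i)) hf.2.2

theorem ncard_gapChains_last_eq {b : Fin (n + 1) → ℕ} {m m' : ℕ} (h : m' + b (Fin.last n) = m) :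
    {f ∈ gapChains b m | f (Fin.last (n + 1)) = m}.ncard =
      (gapChains (fun i => b i.castSucc) m').ncard := by
  refine Set.ncard_congr (fun f _ => fun i => f i.castSucc) ?_ ?_ ?_
  · rintro f ⟨⟨h0, hb, -⟩, hm⟩
    refine ⟨by simpa using h0, fun i => by simpa using hb i.castSucc, ?_⟩
    have : f (Fin.last n).castSucc + b (Fin.last n) ≤ f (Fin.last (n + 1)) := hb (Fin.last n)
    show f (Fin.last n).castSucc ≤ m'
    omega
  · rintro f g ⟨-, hf⟩ ⟨-, hg⟩ he
    funext i
    refine Fin.lastCases (hf.trans hg.symm) (fun i => congrFun he i) i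
  · rintro f ⟨h0, hb, hm⟩
    refine ⟨Fin.snoc (α := fun _ => ℕ) f m, ⟨⟨?_, fun i => ?_, ?_⟩, ?_⟩, ?_⟩
    · rw [← Fin.castSucc_zero, Fin.snoc_castSucc, h0]
    · refine Fin.lastCases ?_ (fun i => ?_) i
      · rw [Fin.snoc_castSucc, Fin.succ_last, Fin.snoc_last]
        omega
      · rw [Fin.snoc_castSucc, ← Fin.castSucc_succ, Fin.snoc_castSucc]
        exact hb i
    · rw [Fin.snoc_last]
    · rw [Fin.snoc_last]
    · funext i
      rw [Fin.snoc_castSucc]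

theorem gapChains_last_lt {b : Fin (n + 1) → ℕ} {m : ℕ} :
    {f ∈ gapChains b (m + 1) | ¬ f (Fin.last (n + 1)) = m + 1} = gapChains b m := by
  ext f
  constructor
  · rintro ⟨⟨h0, hb, hm⟩, hne⟩
    exact ⟨h0, hb, by omega⟩
  · rintro ⟨h0, hb, hm⟩
    exact ⟨⟨h0, hb, by omega⟩, by omega⟩

/-- Pascal's rule: either the last value equals the bound and can be dropped, or the bound can be
lowered by one. Since the gaps sum to at most `n`, the subtraction never truncates. -/
theorem ncard_gapChains {b : Fin n → ℕ} (hb : ∀ i, b i ≤ 1) (m : ℕ) :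
    (gapChains b m).ncard = (n + m - ∑ i, b i).choose n := by
  induction n generalizing m with
  | zero =>
    have : gapChains b m = {fun _ => 0} := by
      ext f
      constructor
      · rintro ⟨h0, -⟩
        exact funext fun i => by rw [Fin.fin_one_eq_zero i]; exact h0
      · rintro rfl
        exact ⟨rfl, fun i => i.elim0, Nat.zero_le _⟩
    simp [this]
  | succ n ih =>
    have hd : ∑ i : Fin n, b i.castSucc ≤ n := by
      simpa using Finset.sum_le_card_nsmul Finset.univ (fun i : Fin n => b i.castSucc) 1
        fun i _ => hb _
    have hl := hb (Fin.last n)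
    have hsum := Fin.sum_univ_castSucc b
    have ih' := fun m => ih (b := fun i => b i.castSucc) (fun i => hb _) m
    set d := ∑ i : Fin n, b i.castSucc
    induction m with
    | zero =>
      -- With bound 0 only the zero chain is possible, and it is allowed exactly when all gaps
      -- vanish.
      have hall : gapChains b 0 = {f ∈ gapChains b 0 | f (Fin.last (n + 1)) = 0} := by
        ext f
        exact ⟨fun h => ⟨h, Nat.le_zero.1 h.2.2⟩, fun h => h.1⟩
      rcases Nat.le_one_iff_eq_zero_or_eq_one.1 hl with h | h
      · rw [hall, ncard_gapChains_last_eq (m' := 0) (by omega), ih', hsum, h]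
        rcases Nat.eq_zero_or_pos d with h0 | h0
        · simp [h0]
        · rw [Nat.choose_eq_zero_of_lt (by omega), Nat.choose_eq_zero_of_lt (by omega)]
      · rw [hsum, Nat.choose_eq_zero_of_lt (by omega),
          Set.ncard_eq_zero (finite_gapChains b 0)]
        ext f
        simp only [Set.mem_empty_iff_false, iff_false]
        rintro ⟨-, hb', hm⟩
        have : f (Fin.last n).castSucc + b (Fin.last n) ≤ f (Fin.last (n + 1)) :=
          hb' (Fin.last n)
        omega
    | succ m ihm =>
      have hsplit := Set.ncard_inter_add_ncard_sdiff_eq_ncard (gapChains b (m + 1))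
        {f | f (Fin.last (n + 1)) = m + 1} (finite_gapChains b (m + 1))
      have h₁ := ncard_gapChains_last_eq (b := b) (m := m + 1) (m' := m + 1 - b (Fin.last n))
        (by omega)
      have h₂ := congrArg Set.ncard (gapChains_last_lt (b := b) (m := m))
      change (gapChains b (m + 1) ∩ {f | f (Fin.last (n + 1)) = m + 1}).ncard = _ at h₁
      change (gapChains b (m + 1) \ {f | f (Fin.last (n + 1)) = m + 1}).ncard = _ at h₂
      rw [← hsplit, h₁, h₂, ihm, ih', hsum,
        show n + 1 + (m + 1) - (d + b (Fin.last n)) =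
          (n + (m + 1 - b (Fin.last n)) - d) + 1 by omega, Nat.choose_succ_succ,
        show n + 1 + m - (d + b (Fin.last n)) = n + (m + 1 - b (Fin.last n)) - d by omega]

end GapChains

/-! ### Words compatible with a signed involution -/

/-- The integer with absolute value `a + 1`, negative if `e` is true. -/
def signedValue (e : Bool) (a : ℕ) : ℤ := if e then -((a : ℤ) + 1) else (a : ℤ) + 1

/-- The pairs of an involution `τ` and a sign function that is constant on its orbits. -/
def signedPairings (n : ℕ) : Finset ((Fin n → Fin n) × (Fin n → Bool)) :=
  Finset.univ.filter fun j => (∀ i, j.1 (j.1 i) = i) ∧ ∀ i, j.2 (j.1 i) = j.2 i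

/-- The word `0, π_1, …, π_n` of a signed function. -/
def signedWord {n : ℕ} (j : (Fin n → Fin n) × (Fin n → Bool)) : Fin (n + 1) → ℤ :=
  Fin.cons 0 fun i => signedValue (j.2 i) (j.1 i)

/-- The indicator function of the descents of a signed word. -/
def descentIndicator {n : ℕ} (j : (Fin n → Fin n) × (Fin n → Bool)) (i : Fin n) : ℕ :=
  if RLt (signedWord j i.succ) (signedWord j i.castSucc) then 1 else 0

theorem descentIndicator_le_one {n : ℕ} (j : (Fin n → Fin n) × (Fin n → Bool)) (i : Fin n) :
    descentIndicator j i ≤ 1 := by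
  unfold descentIndicator
  split_ifs <;> simp

/-- The pairs of equal parity in `{0, …, 2m}`. -/
def parityPairs (m : ℕ) : Finset (Fin (2 * m + 1) × Fin (2 * m + 1)) :=
  Finset.univ.filter fun p => p.1.1 % 2 = p.2.1 % 2

/-- The words `c` with parity `ε` such that `i ↦ (c i, τ i)` increases lexicographically. -/
def parityWords {n : ℕ} (m : ℕ) (j : (Fin n → Fin n) × (Fin n → Bool)) :
    Set (Fin n → Fin (2 * m + 1)) :=
  {c | StrictMono (fun i => toLex (c i, j.1 i)) ∧ ∀ i, (c i).1 % 2 = (j.2 i).toNat}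

theorem RLt_signedValue_iff (e e' : Bool) (a a' : ℕ) :
    RLt (signedValue e' a') (signedValue e a) ↔
      (e' = true ∧ e = false) ∨ (e' = e ∧ a' < a) := by
  unfold RLt signedValue
  cases e <;> cases e' <;> simp <;> omega

theorem RLt_signedValue_zero_iff (e : Bool) (a : ℕ) : RLt (signedValue e a) 0 ↔ e = true := by
  unfold RLt signedValue
  cases e <;> simp <;> omega

/-- Halving upwards sends `2f - 1` and `2f` to `f`, so in each block the odd (negative) letter
precedes the even (positive) one. A strict increase of the half is therefore forced exactly at a
descent: when the sign passes from plus to minus, or when the sign stays and the absolute value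
drops. -/
theorem half_add_le_half_iff {e e' : Bool} {a a' c c' : ℕ} (ha : a ≠ a')
    (hc : c % 2 = e.toNat) (hc' : c' % 2 = e'.toNat) :
    (c + 1) / 2 + (if RLt (signedValue e' a') (signedValue e a) then 1 else 0) ≤ (c' + 1) / 2 ↔
      c < c' ∨ c = c' ∧ a < a' := by
  simp only [RLt_signedValue_iff]
  split_ifs with h
  · cases e <;> cases e' <;> simp at h hc hc' <;> omega
  · cases e <;> cases e' <;> simp at h hc hc' <;> omega

theorem strictMono_iff_gap {n m : ℕ} {j : (Fin (n + 1) → Fin (n + 1)) × (Fin (n + 1) → Bool)}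
    (hj : Function.Injective j.1) {c : Fin (n + 1) → Fin (2 * m + 1)}
    (hc : ∀ i, (c i).1 % 2 = (j.2 i).toNat) :
    StrictMono (fun i => toLex (c i, j.1 i)) ↔
      (Fin.cons 0 fun i => ((c i).1 + 1) / 2 : Fin (n + 2) → ℕ) ∈
        gapChains (descentIndicator j) m := by
  have hlast : (Fin.cons 0 fun i => ((c i).1 + 1) / 2 : Fin (n + 2) → ℕ) (Fin.last (n + 1)) ≤ m := by
    rw [← Fin.succ_last, Fin.cons_succ]
    have := (c (Fin.last n)).2
    omega
  rw [Fin.strictMono_iff_lt_succ]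
  simp only [gapChains, Set.mem_ofPred_eq, Fin.cons_zero, true_and, hlast, and_true]
  rw [Fin.forall_fin_succ]
  -- The gap at position 0 holds automatically: a descent there means that the first entry is
  -- negative, so its letter is odd and has half at least 1.
  have h0 : (Fin.cons 0 fun i => ((c i).1 + 1) / 2 : Fin (n + 2) → ℕ) (Fin.castSucc 0) +
      descentIndicator j 0 ≤
        (Fin.cons 0 fun i => ((c i).1 + 1) / 2 : Fin (n + 2) → ℕ) (Fin.succ 0) := by
    have := hc 0
    simp only [descentIndicator, signedWord, Fin.castSucc_zero, Fin.cons_zero, Fin.cons_succ,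
      RLt_signedValue_zero_iff]
    cases h : j.2 0 <;> simp [h] at this ⊢
    omega
  simp only [h0, true_and]
  refine forall_congr' fun i => ?_
  have hne : ((j.1 i.castSucc : Fin (n + 1)) : ℕ) ≠ j.1 i.succ := fun h => by
    have := congrArg Fin.val (hj (Fin.ext h))
    simp at this
  rw [descentIndicator, signedWord, ← Fin.succ_castSucc, Fin.cons_succ, Fin.cons_succ,
    Fin.cons_succ, Fin.cons_succ, half_add_le_half_iff hne (hc _) (hc _),
    Prod.Lex.toLex_lt_toLex]
  simp only [Fin.lt_def, Fin.ext_iff]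

/-- The word starts at 0, so a descent occurs at or before any negative entry. This keeps the letter
`2 * f - 1` recovered from a chain from truncating. -/
theorem one_le_of_negative {n m : ℕ} {j : (Fin (n + 1) → Fin (n + 1)) × (Fin (n + 1) → Bool)}
    {f : Fin (n + 2) → ℕ} (hf : f ∈ gapChains (descentIndicator j) m) (i : Fin (n + 1))
    (hi : j.2 i = true) : 1 ≤ f i.succ := by
  induction i using Fin.induction with
  | zero =>
    have h : descentIndicator j 0 = 1 := by
      simp [descentIndicator, signedWord, RLt_signedValue_zero_iff, hi]
    have := hf.2.1 0
    omega
  | succ i ih =>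
    have h₁ := hf.2.1 i.succ
    rw [← Fin.succ_castSucc] at h₁
    cases h : j.2 i.castSucc with
    | true =>
      have := ih h
      omega
    | false =>
      have : descentIndicator j i.succ = 1 := by
        rw [descentIndicator, signedWord, ← Fin.succ_castSucc, Fin.cons_succ, Fin.cons_succ,
          if_pos ((RLt_signedValue_iff _ _ _ _).2 (Or.inl ⟨hi, h⟩))]
      omega

theorem ncard_parityWords {n m : ℕ} (hn : n ≠ 0) {j : (Fin n → Fin n) × (Fin n → Bool)}
    (hj : Function.Injective j.1) :
    (parityWords m j).ncard = (n + m - ∑ i, descentIndicator j i).choose n := by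
  rw [← ncard_gapChains (descentIndicator_le_one j)]
  obtain ⟨n, rfl⟩ := Nat.exists_eq_succ_of_ne_zero hn
  refine Set.ncard_congr (fun c _ => Fin.cons 0 fun i => ((c i).1 + 1) / 2) ?_ ?_ ?_
  · rintro c ⟨hc, hp⟩
    exact (strictMono_iff_gap hj hp).1 hc
  · rintro c c' ⟨-, hp⟩ ⟨-, hp'⟩ h
    funext i
    have h₁ := congrFun h i.succ
    simp only [Fin.cons_succ] at h₁
    have h₂ := (hp i).trans (hp' i).symm
    exact Fin.ext (by omega)
  · intro f hf
    have hle : ∀ i : Fin (n + 1), f i.succ ≤ m := fun i =>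
      le_trans (monotone_of_mem_gapChains hf (Fin.le_last _)) hf.2.2
    let c : Fin (n + 1) → Fin (2 * m + 1) := fun i =>
      ⟨2 * f i.succ - (j.2 i).toNat, by have := hle i; omega⟩
    have hp : ∀ i, (c i).1 % 2 = (j.2 i).toNat := by
      intro i
      have := one_le_of_negative hf i
      simp only [c]
      cases h : j.2 i <;> simp [h] at this ⊢
      omega
    have hcf : (Fin.cons 0 fun i => ((c i).1 + 1) / 2 : Fin (n + 2) → ℕ) = f := by
      funext i
      refine Fin.cases hf.1.symm (fun i => ?_) i
      have := one_le_of_negative hf i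
      simp only [c, Fin.cons_succ]
      cases h : j.2 i <;> simp [h] at this ⊢ <;> omega
    exact ⟨c, ⟨(strictMono_iff_gap hj hp).2 (by rwa [hcf]), hp⟩, hcf⟩

theorem ncard_colouredInvolutions_parityPairs {n m : ℕ} (hn : n ≠ 0) :
    (colouredInvolutions (parityPairs m) n).ncard =
      ∑ j ∈ signedPairings n, (n + m - ∑ i, descentIndicator j i).choose n := by
  classical
  have hfin : (colouredInvolutions (parityPairs m) n).Finite := Set.toFinite _
  rw [Set.ncard_eq_toFinset_card _ hfin]
  -- Coloured involutions are grouped by the involution and the parities of the letters; equal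
  -- parity of `c i` and `c (σ i)` makes the signs constant on orbits.
  let F : (Fin n → Fin (2 * m + 1)) × Equiv.Perm (Fin n) → (Fin n → Fin n) × (Fin n → Bool) :=
    fun p => (p.2, fun i => decide ((p.1 i).1 % 2 = 1))
  rw [Finset.card_eq_sum_card_fiberwise (f := F) (t := signedPairings n)]
  · refine Finset.sum_congr rfl fun j hj => ?_
    obtain ⟨hj₁, hj₂⟩ := (Finset.mem_filter.1 hj).2
    have hinv : Function.Involutive j.1 := hj₁
    rw [← ncard_parityWords hn hinv.injective, ← Set.ncard_coe_finset]
    refine Set.ncard_congr (fun p _ => p.1) ?_ ?_ ?_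
    · rintro ⟨c, σ⟩ hmem
      obtain ⟨hp, rfl⟩ : (c, σ) ∈ colouredInvolutions (parityPairs m) n ∧ F (c, σ) = j := by
        simpa using hmem
      refine ⟨hp.1, fun i => ?_⟩
      simp only [F]
      rcases Nat.mod_two_eq_zero_or_one (c i).1 with h | h <;> simp [h]
    · rintro ⟨c, σ⟩ ⟨c', σ'⟩ hp hp' h
      obtain ⟨-, rfl⟩ : (c, σ) ∈ colouredInvolutions (parityPairs m) n ∧ F (c, σ) = j := by
        simpa using hp
      have hF := (by simpa using hp' :
        (c', σ') ∈ colouredInvolutions (parityPairs m) n ∧ F (c', σ') = F (c, σ)).2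
      exact Prod.ext h (DFunLike.coe_injective (congrArg Prod.fst hF).symm)
    · rintro c ⟨hc, hp⟩
      have hF : F (c, hinv.toPerm) = j := by
        refine Prod.ext rfl (funext fun i => ?_)
        have := hp i
        simp only [F]
        cases h : j.2 i <;> simp [h] at this ⊢ <;> omega
      refine ⟨(c, hinv.toPerm), ?_, rfl⟩
      simp only [Finset.coe_filter, Set.Finite.mem_toFinset, Set.mem_ofPred_eq, hF, and_true]
      refine ⟨hc, hinv, fun i => ?_⟩
      simp [parityPairs, hp, hj₂]
  · intro p hp
    have hp : p ∈ colouredInvolutions (parityPairs m) n := by simpa using hp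
    simp only [signedPairings, Finset.coe_filter, Finset.mem_univ, true_and, Set.mem_ofPred_eq, F]
    refine ⟨hp.2.1, fun i => ?_⟩
    have := hp.2.2 i
    simp only [parityPairs, Finset.mem_filter, Finset.mem_univ, true_and] at this
    simp [this]

theorem card_parityPairs (m : ℕ) : (parityPairs m).card = 2 * m ^ 2 + 2 * m + 1 := by
  have hcount : ∀ r < 2, ((Finset.univ : Finset (Fin (2 * m + 1))).filter
      fun x => x.1 % 2 = r).card = m + 1 - r := by
    intro r hr
    rw [← Finset.card_range (m + 1 - r)]
    symm
    refine Finset.card_bij (fun i hi => ⟨2 * i + r, by have := Finset.mem_range.1 hi; omega⟩)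
      ?_ ?_ ?_
    · intro i _
      simp only [Finset.mem_filter, Finset.mem_univ, true_and]
      omega
    · intro i _ j _ h
      have := congrArg Fin.val h
      simp only at this
      omega
    · intro x hx
      have hx := (Finset.mem_filter.1 hx).2
      have := x.2
      refine ⟨x.1 / 2, Finset.mem_range.2 (by omega), Fin.ext ?_⟩
      simp only
      omega
  rw [Finset.card_eq_sum_card_fiberwise (t := Finset.range 2) (f := fun p => p.1.1 % 2)
    (fun p _ => Finset.mem_coe.2 (Finset.mem_range.2 (Nat.mod_lt _ two_pos)))]
  -- There are `m + 1` even and `m` odd letters, which gives `(m + 1)² + m²` pairs.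
  have : ∀ r ∈ Finset.range 2, ((parityPairs m).filter fun p => p.1.1 % 2 = r).card =
      (m + 1 - r) * (m + 1 - r) := by
    intro r hr
    rw [← hcount r (Finset.mem_range.1 hr), ← Finset.card_product]
    congr 1
    ext p
    simp only [parityPairs, Finset.mem_filter, Finset.mem_univ, true_and, Finset.mem_product]
    omega
  rw [Finset.sum_congr rfl this]
  simp [Finset.sum_range_succ]
  ring

theorem sum_signedPairings_recurrence {n : ℕ} (hn : n ≠ 0) (m : ℕ) :
    (n + 2) * ∑ j ∈ signedPairings (n + 2), (n + 2 + m - ∑ i, descentIndicator j i).choose (n + 2) =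
      (2 * m + 1) *
        ∑ j ∈ signedPairings (n + 1), (n + 1 + m - ∑ i, descentIndicator j i).choose (n + 1) +
      (n + (2 * m ^ 2 + 2 * m + 1)) *
        ∑ j ∈ signedPairings n, (n + m - ∑ i, descentIndicator j i).choose n := by
  rw [← ncard_colouredInvolutions_parityPairs hn,
    ← ncard_colouredInvolutions_parityPairs n.succ_ne_zero,
    ← ncard_colouredInvolutions_parityPairs (n + 1).succ_ne_zero,
    ncard_colouredInvolutions, ncard_colouredInvolutions, ncard_colouredInvolutions,
    card_symmMatrices_recurrence, card_parityPairs, Fintype.card_fin]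
  · intro a
    simp [parityPairs]
  · intro p hp
    simp only [parityPairs, Finset.mem_filter, Finset.mem_univ, true_and] at hp ⊢
    exact hp.symm

/-! ### Signed involutions as involutions with signs -/

section Pairings

variable {n : ℕ}

theorem signedValue_injective {e e' : Bool} {a a' : ℕ}
    (h : signedValue e a = signedValue e' a') : e = e' ∧ a = a' := by
  unfold signedValue at h
  cases e <;> cases e' <;> simp at h ⊢ <;> omega

theorem SignedSet.coe_neg (a : SignedSet n) : ((-a : SignedSet n) : ℤ) = -(a : ℤ) := rfl

theorem SignedSet.cases (a : SignedSet n) :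
    a = ofNat 0 (Nat.zero_le n) ∨ (∃ i : Fin n, a = ofNat (i + 1) i.2) ∨
      ∃ i : Fin n, a = -ofNat (i + 1) i.2 := by
  have ha := a.2
  rcases lt_trichotomy (a : ℤ) 0 with h | h | h
  · refine Or.inr (Or.inr ⟨⟨(-(a : ℤ) - 1).toNat, by omega⟩, Subtype.ext ?_⟩)
    rw [SignedSet.coe_neg]
    simp only [ofNat]
    omega
  · exact Or.inl (Subtype.ext h)
  · refine Or.inr (Or.inl ⟨⟨((a : ℤ) - 1).toNat, by omega⟩, Subtype.ext ?_⟩)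
    simp only [ofNat]
    omega

theorem Hyperoctahedral.map_neg (π : Hyperoctahedral n) (a : SignedSet n) :
    π.1 (-a) = -π.1 a := π.2 a

theorem Hyperoctahedral.entry_zero (π : Hyperoctahedral n) : entry π 0 (Nat.zero_le n) = 0 := by
  have h := congrArg Subtype.val (map_neg π (SignedSet.ofNat 0 (Nat.zero_le n)))
  rw [SignedSet.coe_neg,
    show -(SignedSet.ofNat 0 (Nat.zero_le n) : SignedSet n) = SignedSet.ofNat 0 (Nat.zero_le n)
      from rfl] at h
  unfold entry
  omega

theorem Hyperoctahedral.entry_succ_ne_zero (π : Hyperoctahedral n) (i : Fin n) :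
    entry π (i + 1) i.2 ≠ 0 := by
  intro h
  have h' : SignedSet.ofNat (i + 1) i.2 = SignedSet.ofNat 0 (Nat.zero_le n) :=
    π.1.injective (Subtype.ext (h.trans (entry_zero π).symm))
  have := congrArg Subtype.val h'
  simp only [SignedSet.ofNat] at this
  omega

/-- The absolute values and signs of the entries of a signed permutation. -/
def Hyperoctahedral.toPairing (π : Hyperoctahedral n) : (Fin n → Fin n) × (Fin n → Bool) :=
  (fun i => ⟨(entry π (i + 1) i.2).natAbs - 1, by
      have := i.2
      have := (π.1 (SignedSet.ofNat (i + 1) i.2)).2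
      unfold entry
      omega⟩,
    fun i => decide (entry π (i + 1) i.2 < 0))

theorem Hyperoctahedral.signedValue_toPairing (π : Hyperoctahedral n) (i : Fin n) :
    signedValue ((toPairing π).2 i) ((toPairing π).1 i) = entry π (i + 1) i.2 := by
  have := entry_succ_ne_zero π i
  simp only [toPairing, signedValue, decide_eq_true_eq]
  split_ifs <;> omega

theorem Hyperoctahedral.signedWord_toPairing (π : Hyperoctahedral n) (i : Fin (n + 1)) :
    signedWord (toPairing π) i = entry π i (Nat.le_of_lt_succ i.2) := by
  refine Fin.cases ?_ (fun i => ?_) i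
  · exact (entry_zero π).symm
  · exact signedValue_toPairing π i

theorem Hyperoctahedral.sum_descentIndicator_toPairing (π : Hyperoctahedral n) :
    ∑ i, descentIndicator (toPairing π) i = rDes π := by
  rw [rDes, rDescents, Finset.card_filter]
  refine Finset.sum_congr rfl fun i _ => ?_
  simp only [descentIndicator, signedWord_toPairing]
  rfl

theorem Hyperoctahedral.toPairing_injective :
    Function.Injective (toPairing : Hyperoctahedral n → _) := by
  intro π ρ h
  have he : ∀ i : Fin n, π.1 (SignedSet.ofNat (i + 1) i.2) = ρ.1 (SignedSet.ofNat (i + 1) i.2) :=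
    fun i => Subtype.ext (by
      have := signedValue_toPairing π i
      rw [h, signedValue_toPairing] at this
      exact this.symm)
  refine Subtype.ext (Equiv.ext fun a => ?_)
  rcases SignedSet.cases a with rfl | ⟨i, rfl⟩ | ⟨i, rfl⟩
  · exact Subtype.ext ((entry_zero π).trans (entry_zero ρ).symm)
  · exact he i
  · rw [map_neg, map_neg, he]

theorem Hyperoctahedral.toPairing_mem {π : Hyperoctahedral n} (hπ : π⁻¹ = π) :
    (toPairing π) ∈ signedPairings n := by
  have hππ : ∀ a, π.1 (π.1 a) = a := fun a => by
    have h : π * π = 1 := by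
      nth_rewrite 1 [← hπ]
      exact inv_mul_cancel π
    exact congrArg (fun ρ : Hyperoctahedral n => ρ.1 a) h
  -- This is `π (π (i + 1)) = i + 1`, with the sign of the inner value moved across by oddness.
  -- Comparing absolute values and signs gives both defining conditions.
  have key : ∀ i,
      signedValue ((toPairing π).2 ((toPairing π).1 i)) ((toPairing π).1 ((toPairing π).1 i)) =
        signedValue ((toPairing π).2 i) i := by
    intro i
    rw [signedValue_toPairing]
    have h := signedValue_toPairing π i
    have h' := hππ (SignedSet.ofNat (i + 1) i.2)
    unfold signedValue at h ⊢
    set k : Fin n := (toPairing π).1 i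
    cases he : (toPairing π).2 i with
    | false =>
      have : π.1 (SignedSet.ofNat (i + 1) i.2) = SignedSet.ofNat (k + 1) k.2 :=
        Subtype.ext (by simpa [he, entry, SignedSet.ofNat] using h.symm)
      rw [this] at h'
      have := congrArg Subtype.val h'
      simpa [entry, SignedSet.ofNat] using this
    | true =>
      have : π.1 (SignedSet.ofNat (i + 1) i.2) = -SignedSet.ofNat (k + 1) k.2 :=
        Subtype.ext (by
          rw [SignedSet.coe_neg]
          simpa [he, entry, SignedSet.ofNat] using h.symm)
      rw [this, map_neg] at h'
      have := congrArg Subtype.val h'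
      rw [SignedSet.coe_neg, neg_eq_iff_eq_neg] at this
      simpa [entry, SignedSet.ofNat] using this
  simp only [signedPairings, Finset.mem_filter, Finset.mem_univ, true_and]
  exact ⟨fun i => Fin.ext (signedValue_injective (key i)).2,
    fun i => (signedValue_injective (key i)).1⟩

/-- The odd function on `Ω_n` given by absolute values and signs. -/
def signedExtension (j : (Fin n → Fin n) × (Fin n → Bool)) (a : SignedSet n) : SignedSet n :=
  if h : 0 < (a : ℤ) then
    let i : Fin n := ⟨((a : ℤ) - 1).toNat, by have := a.2; omega⟩
    if j.2 i then -SignedSet.ofNat (j.1 i + 1) (j.1 i).2 else SignedSet.ofNat (j.1 i + 1) (j.1 i).2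
  else if h' : (a : ℤ) < 0 then
    let i : Fin n := ⟨(-(a : ℤ) - 1).toNat, by have := a.2; omega⟩
    if j.2 i then SignedSet.ofNat (j.1 i + 1) (j.1 i).2 else -SignedSet.ofNat (j.1 i + 1) (j.1 i).2
  else SignedSet.ofNat 0 (Nat.zero_le n)

theorem SignedSet.neg_neg (a : SignedSet n) : - -a = a :=
  Subtype.ext (by rw [coe_neg, coe_neg]; exact _root_.neg_neg _)

theorem signedExtension_zero (j : (Fin n → Fin n) × (Fin n → Bool)) :
    signedExtension j (SignedSet.ofNat 0 (Nat.zero_le n)) = SignedSet.ofNat 0 (Nat.zero_le n) := by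
  simp [signedExtension, SignedSet.ofNat]

theorem signedExtension_pos (j : (Fin n → Fin n) × (Fin n → Bool)) (i : Fin n) :
    signedExtension j (SignedSet.ofNat (i + 1) i.2) =
      if j.2 i then -SignedSet.ofNat (j.1 i + 1) (j.1 i).2
      else SignedSet.ofNat (j.1 i + 1) (j.1 i).2 := by
  rw [signedExtension, dif_pos (by simp only [SignedSet.ofNat]; omega)]
  have : ∀ h, (⟨(((SignedSet.ofNat (i + 1) i.2 : SignedSet n) : ℤ) - 1).toNat, h⟩ : Fin n) = i :=
    fun h => Fin.ext (by simp [SignedSet.ofNat])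
  simp only [this]

theorem signedExtension_neg (j : (Fin n → Fin n) × (Fin n → Bool)) (a : SignedSet n) :
    signedExtension j (-a) = -signedExtension j a := by
  have hneg : ∀ i : Fin n, signedExtension j (-SignedSet.ofNat (i + 1) i.2) =
      -signedExtension j (SignedSet.ofNat (i + 1) i.2) := by
    intro i
    rw [signedExtension_pos, signedExtension,
      dif_neg (by rw [SignedSet.coe_neg]; simp only [SignedSet.ofNat]; omega),
      dif_pos (by rw [SignedSet.coe_neg]; simp only [SignedSet.ofNat]; omega)]
    have : ∀ h, (⟨(-((-SignedSet.ofNat (i + 1) i.2 : SignedSet n) : ℤ) - 1).toNat, h⟩ : Fin n) = i :=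
      fun h => Fin.ext (by simp [SignedSet.coe_neg, SignedSet.ofNat])
    simp only [this]
    split_ifs
    · rw [SignedSet.neg_neg]
    · rfl
  rcases SignedSet.cases a with rfl | ⟨i, rfl⟩ | ⟨i, rfl⟩
  · have h : -(SignedSet.ofNat 0 (Nat.zero_le n) : SignedSet n) =
      SignedSet.ofNat 0 (Nat.zero_le n) := rfl
    rw [h, signedExtension_zero, h]
  · exact hneg i
  · rw [hneg, SignedSet.neg_neg, SignedSet.neg_neg]

theorem signedExtension_involutive {j : (Fin n → Fin n) × (Fin n → Bool)}
    (hj : j ∈ signedPairings n) : Function.Involutive (signedExtension j) := by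
  obtain ⟨h₁, h₂⟩ := (Finset.mem_filter.1 hj).2
  have hpos : ∀ i : Fin n, signedExtension j (signedExtension j (SignedSet.ofNat (i + 1) i.2)) =
      SignedSet.ofNat (i + 1) i.2 := by
    intro i
    rw [signedExtension_pos]
    split_ifs with h
    · rw [signedExtension_neg, signedExtension_pos, h₂, if_pos h, SignedSet.neg_neg]
      simp only [h₁]
    · rw [signedExtension_pos, h₂, if_neg h]
      simp only [h₁]
  intro a
  rcases SignedSet.cases a with rfl | ⟨i, rfl⟩ | ⟨i, rfl⟩
  · rw [signedExtension_zero, signedExtension_zero]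
  · exact hpos i
  · rw [signedExtension_neg, signedExtension_neg, hpos]

theorem exists_toPairing_eq {j : (Fin n → Fin n) × (Fin n → Bool)} (hj : j ∈ signedPairings n) :
    ∃ π : Hyperoctahedral n, π⁻¹ = π ∧ (Hyperoctahedral.toPairing π) = j := by
  refine ⟨⟨(signedExtension_involutive hj).toPerm, signedExtension_neg j⟩, rfl, ?_⟩
  set π : Hyperoctahedral n := ⟨(signedExtension_involutive hj).toPerm, signedExtension_neg j⟩
  have he : ∀ i, signedValue ((Hyperoctahedral.toPairing π).2 i)
      ((Hyperoctahedral.toPairing π).1 i) = signedValue (j.2 i) (j.1 i) := by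
    intro i
    rw [Hyperoctahedral.signedValue_toPairing]
    have := congrArg Subtype.val (signedExtension_pos j i)
    refine this.trans ?_
    rw [signedValue]
    split_ifs <;> simp [SignedSet.coe_neg, SignedSet.ofNat]
  exact Prod.ext (funext fun i => Fin.ext (signedValue_injective (he i)).2)
    (funext fun i => (signedValue_injective (he i)).1)

theorem signedInvolutionCount_eq (n : ℕ) (k : ℤ) :
    signedInvolutionCount n k =
      ((signedPairings n).filter fun j => ((∑ i, descentIndicator j i : ℕ) : ℤ) = k).card := by
  rw [signedInvolutionCount, ← Set.ncard_coe_finset,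
    ← (Hyperoctahedral.toPairing_injective.injOn (s := signedInvolutions n k)).ncard_image]
  congr 1
  ext j
  rw [Finset.mem_coe, Finset.mem_filter]
  constructor
  · rintro ⟨π, ⟨hπ, hk⟩, rfl⟩
    rw [Hyperoctahedral.sum_descentIndicator_toPairing]
    exact ⟨Hyperoctahedral.toPairing_mem hπ, hk⟩
  · rintro ⟨hj, hk⟩
    obtain ⟨π, hπ, rfl⟩ := exists_toPairing_eq hj
    rw [Hyperoctahedral.sum_descentIndicator_toPairing] at hk
    exact ⟨π, ⟨hπ, hk⟩, rfl⟩

theorem signedInvolutionCount_of_neg {k : ℤ} (hk : k < 0) : signedInvolutionCount n k = 0 := by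
  rw [signedInvolutionCount_eq, Finset.card_eq_zero, Finset.filter_eq_empty_iff]
  intro j _
  omega

/-- Only `k ≤ m` contributes, since `(n + m - k).choose n` vanishes for larger `k`. -/
theorem sum_signedPairings_eq (m : ℕ) :
    ∑ j ∈ signedPairings n, (n + m - ∑ i, descentIndicator j i).choose n =
      ∑ k ∈ Finset.range (m + 1), signedInvolutionCount n k * (n + m - k).choose n := by
  have hle : ∀ j : (Fin n → Fin n) × (Fin n → Bool), ∑ i, descentIndicator j i ≤ n := fun j => by
    simpa using Finset.sum_le_card_nsmul Finset.univ (descentIndicator j) 1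
      fun i _ => descentIndicator_le_one j i
  have h₁ : ∑ j ∈ signedPairings n, (n + m - ∑ i, descentIndicator j i).choose n =
      ∑ k ∈ Finset.range (n + m + 1), signedInvolutionCount n k * (n + m - k).choose n := by
    rw [← Finset.sum_fiberwise_of_maps_to (s := signedPairings n) (t := Finset.range (n + m + 1))
      (g := fun j => ∑ i, descentIndicator j i)
      (fun j _ => Finset.mem_range.2 (by have := hle j; omega))]
    refine Finset.sum_congr rfl fun k _ => ?_
    rw [signedInvolutionCount_eq, Finset.sum_congr rfl fun j hj => by
      rw [(Finset.mem_filter.1 hj).2], Finset.sum_const, smul_eq_mul]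
    simp only [Nat.cast_inj]
  rw [h₁]
  symm
  refine Finset.sum_subset (Finset.range_mono (by omega)) fun k hk hk' => ?_
  rw [Finset.mem_range] at hk hk'
  rw [Nat.choose_eq_zero_of_lt (by omega), mul_zero]

end Pairings

/-! ### From the summed recurrence to its coefficients -/

theorem sum_range_shift {m : ℕ} (g : ℤ → ℤ) (v : ℕ → ℤ) (hg : g (-1) = 0) (hv : v (m + 1) = 0) :
    ∑ k ∈ Finset.range (m + 1), g ((k : ℤ) - 1) * v k =
      ∑ k ∈ Finset.range (m + 1), g k * v (k + 1) := by
  rw [Finset.sum_range_succ', Finset.sum_range_succ, hv]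
  simp [hg]

/-- With `m = k + t` this absorbs the factor `2m + 1`. The coefficients on the right are those of
the theorem, taken at `k` and at `k + 1`; Pascal's rule and the absorption identity prove it. -/
theorem choose_combination_one (n k t : ℕ) :
    (2 * ((k : ℤ) + t) + 1) * ((n + 1 + t).choose (n + 1) : ℤ) =
      (2 * k + 1) * ((n + 2 + t).choose (n + 2) : ℤ) +
        (2 * ((n : ℤ) + 2) - 2 * (k + 1) + 1) * ((n + 1 + t).choose (n + 2) : ℤ) := by
  have h₁ : ((n + 2 + t).choose (n + 2) : ℤ) =
      (n + 1 + t).choose (n + 1) + (n + 1 + t).choose (n + 2) := by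
    rw [show n + 2 + t = n + 1 + t + 1 by ring, Nat.choose_succ_succ]
    push_cast
    ring
  have h₂ : ((n + 1 + t).choose (n + 2) : ℤ) * (n + 2) = (n + 1 + t).choose (n + 1) * t := by
    have := Nat.choose_succ_right_eq (n + 1 + t) (n + 1)
    rw [show n + 1 + t - (n + 1) = t by omega] at this
    exact_mod_cast this
  rw [h₁]
  linear_combination -2 * h₂

/-- The analogue for the quadratic factor in `m`, with the coefficients of the theorem taken at `k`,
`k + 1` and `k + 2`. -/
theorem choose_combination_two (n k t : ℕ) :
    ((n : ℤ) + 1 + 2 * (k + t) * (k + t + 1)) * ((n + t).choose n : ℤ) =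
      ((n : ℤ) + 1 + 2 * k * (k + 1)) * ((n + 2 + t).choose (n + 2) : ℤ) +
        (2 * ((n : ℤ) + 1) + 4 * ((n : ℤ) + 2 - (k + 1) - 1) * (k + 1 - 1)) *
          ((n + 1 + t).choose (n + 2) : ℤ) +
        ((2 * (n : ℤ) + 1) * (n + 1) + 2 * (k + 2 - 2) * (k + 2 - 2 * (n + 2) + 1)) *
          ((n + t).choose (n + 2) : ℤ) := by
  have h₁ : ((n + 1 + t).choose (n + 2) : ℤ) = (n + t).choose (n + 1) + (n + t).choose (n + 2) := by
    rw [show n + 1 + t = n + t + 1 by ring, Nat.choose_succ_succ]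
    push_cast
    ring
  have h₂ : ((n + 2 + t).choose (n + 2) : ℤ) =
      (n + t).choose n + 2 * (n + t).choose (n + 1) + (n + t).choose (n + 2) := by
    rw [show n + 2 + t = n + t + 1 + 1 by ring, Nat.choose_succ_succ, Nat.choose_succ_succ,
      Nat.choose_succ_succ]
    push_cast
    ring
  have h₃ : ((n + t).choose (n + 1) : ℤ) * (n + 1) = (n + t).choose n * t := by
    have := Nat.choose_succ_right_eq (n + t) n
    rw [show n + t - n = t by omega] at this
    exact_mod_cast this
  have h₄ : ((n + t).choose (n + 2) : ℤ) * (n + 2) = (n + t).choose (n + 1) * (t - 1) := by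
    -- For `t = 0` the factor `t - 1` is negative, but both binomials vanish.
    rcases t with _ | t
    · rw [Nat.choose_eq_zero_of_lt (by omega), Nat.choose_eq_zero_of_lt (by omega)]
      simp
    · have := Nat.choose_succ_right_eq (n + (t + 1)) (n + 1)
      rw [show n + (t + 1) - (n + 1) = t by omega] at this
      push_cast
      rw [add_sub_cancel_right]
      exact_mod_cast this
  rw [h₁, h₂]
  linear_combination -2 * (2 * (k : ℤ) + t + 1) * h₃ - 2 * ((n : ℤ) + 1) * h₄

theorem signedInvolutionCount_sum_recurrence {n : ℕ} (hn : n ≠ 0) (m : ℕ) :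
    ((n : ℤ) + 2) * ∑ k ∈ Finset.range (m + 1),
        (signedInvolutionCount (n + 2) k : ℤ) * ((n + 2 + m - k).choose (n + 2) : ℤ) =
      (2 * m + 1) * ∑ k ∈ Finset.range (m + 1),
        (signedInvolutionCount (n + 1) k : ℤ) * ((n + 1 + m - k).choose (n + 1) : ℤ) +
      ((n : ℤ) + 1 + 2 * m * (m + 1)) * ∑ k ∈ Finset.range (m + 1),
        (signedInvolutionCount n k : ℤ) * ((n + m - k).choose n : ℤ) := by
  have h := sum_signedPairings_recurrence hn m
  rw [sum_signedPairings_eq, sum_signedPairings_eq, sum_signedPairings_eq] at h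
  have h' := congrArg (Nat.cast : ℕ → ℤ) h
  push_cast at h'
  linear_combination h'

/-- The difference of the two sides of the recurrence, at length `n + 2`. -/
noncomputable def recurrenceDefect (n : ℕ) (k : ℤ) : ℤ :=
  ((n : ℤ) + 2) * signedInvolutionCount (n + 2) k -
    ((2 * k + 1) * signedInvolutionCount (n + 1) k
      + (2 * ((n : ℤ) + 2) - 2 * k + 1) * signedInvolutionCount (n + 1) (k - 1)
      + ((n : ℤ) + 1 + 2 * k * (k + 1)) * signedInvolutionCount n k
      + (2 * ((n : ℤ) + 1) + 4 * ((n : ℤ) + 2 - k - 1) * (k - 1)) * signedInvolutionCount n (k - 1)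
      + ((2 * (n : ℤ) + 1) * (n + 1) + 2 * (k - 2) * (k - 2 * (n + 2) + 1)) *
        signedInvolutionCount n (k - 2))

theorem sum_recurrenceDefect {n : ℕ} (hn : n ≠ 0) (m : ℕ) :
    ∑ k ∈ Finset.range (m + 1), recurrenceDefect n k * ((n + 2 + m - k).choose (n + 2) : ℤ) =
      0 := by
  let v : ℕ → ℤ := fun k => ((n + 2 + m - k).choose (n + 2) : ℤ)
  have hv : ∀ k, m < k → v k = 0 := fun k hk => by
    simp only [v]
    rw [Nat.choose_eq_zero_of_lt (by omega), Nat.cast_zero]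
  have hz : ∀ l : ℕ, ∀ k : ℤ, k < 0 → (signedInvolutionCount l k : ℤ) = 0 := fun l k hk => by
    rw [signedInvolutionCount_of_neg hk, Nat.cast_zero]
  have s₁ := sum_range_shift (m := m)
    (fun k => (2 * ((n : ℤ) + 2) - 2 * (k + 1) + 1) * signedInvolutionCount (n + 1) k) v
    (by simp [hz]) (hv _ (by omega))
  have s₂ := sum_range_shift (m := m)
    (fun k => (2 * ((n : ℤ) + 1) + 4 * ((n : ℤ) + 2 - (k + 1) - 1) * (k + 1 - 1)) *
      signedInvolutionCount n k) v (by simp [hz]) (hv _ (by omega))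
  -- The term with index `k - 2` needs two shifts, `s₃` and then `s₄`. The boundary terms vanish
  -- because the counts are zero at negative indices and the binomials are zero beyond `m`.
  have s₃ := sum_range_shift (m := m)
    (fun k => ((2 * (n : ℤ) + 1) * (n + 1) + 2 * (k + 1 - 2) * (k + 1 - 2 * (n + 2) + 1)) *
      signedInvolutionCount n (k - 1)) v (by simp [hz]) (hv _ (by omega))
  have s₄ := sum_range_shift (m := m)
    (fun k => ((2 * (n : ℤ) + 1) * (n + 1) + 2 * (k + 2 - 2) * (k + 2 - 2 * (n + 2) + 1)) *
      signedInvolutionCount n k) (fun k => v (k + 1)) (by simp [hz]) (hv _ (by omega))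
  have hdefect : ∑ k ∈ Finset.range (m + 1), recurrenceDefect n k * v k =
      ((n : ℤ) + 2) * ∑ k ∈ Finset.range (m + 1), (signedInvolutionCount (n + 2) k : ℤ) * v k -
      (∑ k ∈ Finset.range (m + 1), (2 * (k : ℤ) + 1) * signedInvolutionCount (n + 1) k * v k +
       ∑ k ∈ Finset.range (m + 1), (2 * ((n : ℤ) + 2) - 2 * ((k : ℤ) - 1 + 1) + 1) *
          signedInvolutionCount (n + 1) ((k : ℤ) - 1) * v k +
       ∑ k ∈ Finset.range (m + 1), ((n : ℤ) + 1 + 2 * k * (k + 1)) *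
          signedInvolutionCount n k * v k +
       ∑ k ∈ Finset.range (m + 1), (2 * ((n : ℤ) + 1) + 4 * ((n : ℤ) + 2 - ((k : ℤ) - 1 + 1) - 1) *
          ((k : ℤ) - 1 + 1 - 1)) * signedInvolutionCount n ((k : ℤ) - 1) * v k +
       ∑ k ∈ Finset.range (m + 1), ((2 * (n : ℤ) + 1) * (n + 1) + 2 * ((k : ℤ) - 1 + 1 - 2) *
          ((k : ℤ) - 1 + 1 - 2 * (n + 2) + 1)) *
            signedInvolutionCount n ((k : ℤ) - 1 - 1) * v k) := by
    rw [Finset.mul_sum]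
    simp only [← Finset.sum_add_distrib, ← Finset.sum_sub_distrib]
    refine Finset.sum_congr rfl fun k _ => ?_
    rw [recurrenceDefect, show (k : ℤ) - 1 - 1 = k - 2 by ring]
    ring
  have s₃' : ∀ k : ℕ, ((2 * (n : ℤ) + 1) * (n + 1) + 2 * ((k : ℤ) - 1 + 2 - 2) *
      ((k : ℤ) - 1 + 2 - 2 * (n + 2) + 1)) = ((2 * (n : ℤ) + 1) * (n + 1) + 2 * ((k : ℤ) + 1 - 2) *
      ((k : ℤ) + 1 - 2 * (n + 2) + 1)) := fun k => by ring
  simp only [s₃'] at s₄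
  show ∑ k ∈ Finset.range (m + 1), recurrenceDefect n k * v k = 0
  rw [hdefect, signedInvolutionCount_sum_recurrence hn, s₁, s₂, s₃, s₄, Finset.mul_sum,
    Finset.mul_sum]
  simp only [← Finset.sum_add_distrib, ← Finset.sum_sub_distrib]
  refine Finset.sum_eq_zero fun k hk => ?_
  obtain ⟨t, rfl⟩ := Nat.exists_eq_add_of_le (Nat.lt_succ_iff.1 (Finset.mem_range.1 hk))
  simp only [v]
  rw [show n + 1 + (k + t) - k = n + 1 + t by omega, show n + (k + t) - k = n + t by omega,
    show n + 2 + (k + t) - k = n + 2 + t by omega,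
    show n + 2 + (k + t) - (k + 1) = n + 1 + t by omega,
    show n + 2 + (k + t) - (k + 1 + 1) = n + t by omega]
  have h₁ := choose_combination_one n k t
  have h₂ := choose_combination_two n k t
  push_cast
  linear_combination (signedInvolutionCount (n + 1) k : ℤ) * h₁ +
    (signedInvolutionCount n k : ℤ) * h₂

/-- Taking `m = k` in the summed identity, the earlier defects vanish by induction and the last one
has coefficient `C(n+2, n+2) = 1`. -/
theorem recurrenceDefect_eq_zero {n : ℕ} (hn : n ≠ 0) (k : ℕ) : recurrenceDefect n k = 0 := by
  induction k using Nat.strong_induction_on with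
  | _ k ih =>
    have h := sum_recurrenceDefect hn k
    rw [Finset.sum_range_succ, Finset.sum_eq_zero fun i hi => by
      rw [ih i (Finset.mem_range.1 hi), zero_mul], Nat.add_sub_cancel, Nat.choose_self] at h
    simpa using h

theorem mainTheorem5 :
    (∀ (n : ℕ) (k : ℤ), 3 ≤ n → 0 ≤ k →
      (n : ℤ) * (signedInvolutionCount n k : ℤ) =
        (2 * k + 1) * (signedInvolutionCount (n - 1) k : ℤ)
        + (2 * (n : ℤ) - 2 * k + 1) * (signedInvolutionCount (n - 1) (k - 1) : ℤ)
        + ((n : ℤ) - 1 + 2 * k * (k + 1)) * (signedInvolutionCount (n - 2) k : ℤ)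
        + (2 * ((n : ℤ) - 1) + 4 * ((n : ℤ) - k - 1) * (k - 1))
            * (signedInvolutionCount (n - 2) (k - 1) : ℤ)
        + ((2 * (n : ℤ) - 3) * ((n : ℤ) - 1) + 2 * (k - 2) * (k - 2 * (n : ℤ) + 1))
            * (signedInvolutionCount (n - 2) (k - 2) : ℤ)) ∧
    signedInvolutionCount 1 0 = 1 ∧
    signedInvolutionCount 1 1 = 1 ∧
    signedInvolutionCount 2 0 = 1 ∧
    signedInvolutionCount 2 1 = 4 ∧
    signedInvolutionCount 2 2 = 1 ∧
    (∀ (n : ℕ) (k : ℤ), 1 ≤ n → k < 0 → signedInvolutionCount n k = 0) := by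
  refine ⟨fun n k hn hk => ?_, ?_, ?_, ?_, ?_, ?_, fun n k _ hk => signedInvolutionCount_of_neg hk⟩
  · obtain ⟨n, rfl⟩ := Nat.exists_eq_add_of_le' (show 2 ≤ n by omega)
    obtain ⟨k, rfl⟩ := Int.eq_ofNat_of_zero_le hk
    have h := recurrenceDefect_eq_zero (n := n) (by omega) k
    rw [recurrenceDefect] at h
    rw [show n + 2 - 1 = n + 1 from rfl, Nat.add_sub_cancel]
    push_cast
    linear_combination h
  -- The initial values are finite counts over `signedPairings 1` and `signedPairings 2`.
  all_goals
    rw [signedInvolutionCount_eq]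
    decide
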